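/- Fix $0<\alpha\le\frac12$, $\mathrm{SNR}>0$ and $0\le d_0\le\alpha$. For positive integers $m,n$ let $\mathbf X\in\{0,1\}^n$ have i.i.d. components with $\Pr(X_j=1)=\alpha$, let $\mathbf G\in\mathbb R^{m\times n}$ be drawn from the full-diversity ($\beta=1$) Gaussian ensemble, i.e. $\mathbf G$ is obtained from a matrix with i.i.d. $\mathcal N(0,1)$ entries by dividing each row by its $\ell_2$ norm, let $\mathbf N$ be a vector of $m$ i.i.d. $\mathcal N(0,1)$ variables, with $\mathbf X,\mathbf G,\mathbf N$ independent, and let $\mathbf Y=\sqrt{\mathrm{SNR}}\,\mathbf G\mathbf X+\mathbf N$. Let $d(\mathbf x,\hat{\mathbf x})=\#\{j: x_j\ne\hat x_j\}$ be the Hamming distortion. Define the sensing capacity $$C(d_0)=\sup_{(m_n)}\ \limsup_{n\to\infty}\frac{n}{m_n}\in[0,\infty],$$ where the supremum is over all sequences of integers $m_n\ge1$ for which there are reconstructions $\hat{\mathbf X}=\hat{\mathbf X}_n(\mathbf Y,\mathbf G)\in\{0,1\}^n$ with $\Pr\left(\frac1n d(\mathbf X,\hat{\mathbf X})>d_0\right)\to0$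 as $n\to\infty$ (with $m=m_n$). Let $R_X(d_0)=\inf I(X;\hat X)$ be the rate distortion function of $X\sim\mathrm{Bernoulli}(\alpha)$, the infimum being over all joint laws of $(X,\hat X)$ on $\{0,1\}^2$ with $X\sim\mathrm{Bernoulli}(\alpha)$ and $\Pr(X\ne\hat X)\le d_0$. Logarithms are natural and mutual information is in nats. Then $$C(d_0)\le\frac{\frac12\log(1+\alpha\,\mathrm{SNR})}{R_X(d_0)},$$ where the right-hand side is read as $+\infty$ if $R_X(d_0)=0$. Moreover, for all $m,n$, $$\mathbf E_{\mathbf G}\, I(\mathbf X;\mathbf Y\mid\mathbf G)\le\frac m2\log(1+\alpha\,\mathrm{SNR}).$$ -/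

import Mathlib

open MeasureTheory ProbabilityTheory Filter
open scoped ENNReal

namespace Sensing

noncomputable section

/-- Mutual information (in nats) of a pair of random variables with joint law `π`:
the Kullback–Leibler divergence of `π` from the product of its two marginals. -/
def mutualInfo {S T : Type*} [MeasurableSpace S] [MeasurableSpace T]
    (π : Measure (S × T)) : ℝ≥0∞ :=
  InformationTheory.klDiv π (π.fst.prod π.snd)

/-- The Hamming distortion measure between two letters of an alphabet. -/
def hamming {A : Type*} [DecidableEq A] (a b : A) : ℝ := if a = b then 0 else 1

/-- The scalar rate distortion function (in nats) of a source letter `X` with law `μ`, for a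
nonnegative distortion measure `d`, at the level `D ≥ 0`: the infimum of `I(X; X̂)` over all joint
laws of `(X, X̂)` for which `X` has law `μ` and `E[d(X, X̂)] ≤ D`. -/
def rateDistortion {A : Type*} [MeasurableSpace A] (μ : Measure A) (d : A → A → ℝ) (D : ℝ) :
    ℝ≥0∞ :=
  ⨅ (π : Measure (A × A)) (_ : π.fst = μ)
    (_ : ∫⁻ z, ENNReal.ofReal (d z.1 z.2) ∂π ≤ ENNReal.ofReal D), mutualInfo π

/-- The law of a signal `X ∈ {0,1}ⁿ` with i.i.d. Bernoulli(`α`) components (`true` stands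
for `1` and has probability `α`). -/
def sourceLaw (α : unitInterval) (n : ℕ) : Measure (Fin n → Bool) :=
  Measure.pi fun _ => bernoulliMeasure true false α

/-- The law of an unnormalized entry of a sensing matrix of the Gaussian ensemble with diversity
ratio `β`: the mixture `(1 - β) N(0, 0) + β N(0, 1)`. -/
def entryLaw (β : unitInterval) : Measure ℝ :=
  unitInterval.toNNReal (unitInterval.symm β) • gaussianReal 0 0 +
    unitInterval.toNNReal β • gaussianReal 0 1

/-- Divide each row of a matrix by its `ℓ²` norm. -/
def normalizeRows {m n : ℕ} (A : Fin m → Fin n → ℝ) : Fin m → Fin n → ℝ :=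
  fun i j => A i j / √(∑ k, A i k ^ 2)

/-- The Gaussian ensemble of `m × n` sensing matrices with diversity ratio `β`: the entries are
drawn i.i.d. from `entryLaw β`, and then each row is normalized. -/
def gaussianEnsemble (β : unitInterval) (m n : ℕ) : Measure (Fin m → Fin n → ℝ) :=
  (Measure.pi fun _ : Fin m => Measure.pi fun _ : Fin n => entryLaw β).map normalizeRows

/-- The law of the noise vector: i.i.d. standard Gaussian components. -/
def noiseLaw (m : ℕ) : Measure (Fin m → ℝ) := Measure.pi fun _ => gaussianReal 0 1

/-- The observation `Y = √SNR · G X + N`. -/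
def observe (SNR : ℝ) {m n : ℕ} (G : Fin m → Fin n → ℝ) (x : Fin n → Bool) (w : Fin m → ℝ) :
    Fin m → ℝ :=
  fun i => √SNR * ∑ j, G i j * (if x j then 1 else 0) + w i

/-- The conditional joint law of `(X, Y)` given the sensing matrix `G`. -/
def jointLaw (α : unitInterval) (SNR : ℝ) {m n : ℕ} (G : Fin m → Fin n → ℝ) :
    Measure ((Fin n → Bool) × (Fin m → ℝ)) :=
  ((sourceLaw α n).prod (noiseLaw m)).map fun p => (p.1, observe SNR G p.1 p.2)

/-- The expected conditional mutual information `E_G I(X; Y | G)`. -/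
def expectedMutualInfo (α β : unitInterval) (SNR : ℝ) (m n : ℕ) : ℝ≥0∞ :=
  ∫⁻ G, mutualInfo (jointLaw α SNR G) ∂(gaussianEnsemble β m n)

/-- The probability `Pr((1/n) d(X, X̂) > d₀)` for the Hamming distortion, where the reconstruction
`X̂` is computed from the sensing matrix and the observation, and `X`, `G`, `N` are independent. -/
def errorProb (α β : unitInterval) (SNR d₀ : ℝ) (m n : ℕ)
    (Xhat : (Fin m → Fin n → ℝ) × (Fin m → ℝ) → (Fin n → Bool)) : ℝ≥0∞ :=
  ((sourceLaw α n).prod ((gaussianEnsemble β m n).prod (noiseLaw m)))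
    {ω | d₀ < (1 / (n : ℝ)) *
      ∑ j, hamming (ω.1 j) (Xhat (ω.2.1, observe SNR ω.2.1 ω.1 ω.2.2) j)}

/-- The numbers of sensors `m n ≥ 1`, one for each signal dimension `n`, allow reconstruction to
within the distortion level `d₀`: some (measurable) reconstructions have
`Pr((1/n) d(X, X̂) > d₀) → 0` as `n → ∞`. -/
def Achievable (α β : unitInterval) (SNR d₀ : ℝ) (m : ℕ → ℕ) : Prop :=
  (∀ n, 0 < m n) ∧
    ∃ Xhat : (n : ℕ) → (Fin (m n) → Fin n → ℝ) × (Fin (m n) → ℝ) → (Fin n → Bool),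
      (∀ n, Measurable (Xhat n)) ∧
        Tendsto (fun n => errorProb α β SNR d₀ (m n) n (Xhat n)) atTop (nhds 0)

/-- The sensing capacity `C(d₀) = limsup {n/m : Pr((1/n) d(X, X̂) > d₀) → 0}`: the supremum of
`limsup n / m(n)` over all achievable choices of the numbers of sensors. -/
def sensingCapacity (α β : unitInterval) (SNR d₀ : ℝ) : ℝ≥0∞ :=
  ⨆ (m : ℕ → ℕ) (_ : Achievable α β SNR d₀ m),
    limsup (fun n : ℕ => (n : ℝ≥0∞) / (m n : ℝ≥0∞)) atTop

end

end Sensing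

namespace Sensing

/-! The mutual information between signal and observation, for a fixed sensing matrix, is squeezed
between two bounds.

Above: it is at most the divergence of the joint law from the input law times any output law
(`mutualInfo_le_klDiv_prod`). A product of Gaussians of variance `1 + α SNR`, centred at the mean
output, gives `m/2 · log (1 + α SNR)`, because rows of norm at most one keep the signal variance
below `α SNR`.

Below: Donsker–Varadhan is applied to the sum over `j` of `log (W(x_j | x̂_j) / P(x_j))`, where `P`
is the source law and `W` is a binary symmetric channel with crossover `D`. This sum is affine in
the Hamming distance, so its mean is controlled by the error probability `e`. With `h` the binary
entropy, `rate_le_of_errorProb` gives `n (h(α) + log (1 - D) - log ((1 - D)/D) (d₀ + e)) ≤ m/2 · log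
(1 + α SNR)`.

Let `e → 0` and take `D = d₀`, or `D` small if `d₀ = 0`: `n/m` is asymptotically at most the
capacity term over `h(α) - h(d₀)`. Since the rate distortion function stands in a denominator, only
`R_X(d₀) ≤ h(α) - h(d₀)` is needed, and one test channel shows it (`rateDistortion_bernoulli_le`).
-/

/-! ### Divergence and mutual information -/

/-- The Kullback–Leibler divergence of a measure with density `exp L`. -/
lemma klDiv_eq_of_withDensity_exp {Ω : Type*} [MeasurableSpace Ω] {μ ν : Measure Ω}
    [IsProbabilityMeasure μ] [IsProbabilityMeasure ν] {L : Ω → ℝ} (hL : Measurable L)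
    (hμ : μ = ν.withDensity fun ω => ENNReal.ofReal (Real.exp (L ω))) (hint : Integrable L μ) :
    InformationTheory.klDiv μ ν = ENNReal.ofReal (∫ ω, L ω ∂μ) := by
  have hac : μ ≪ ν := hμ ▸ withDensity_absolutelyContinuous _ _
  have hllr : llr μ ν =ᵐ[μ] L := by
    have h : μ.rnDeriv ν =ᵐ[ν] fun ω => ENNReal.ofReal (Real.exp (L ω)) := by
      rw [hμ]
      exact Measure.rnDeriv_withDensity ν (by fun_prop)
    filter_upwards [hac.ae_le h] with ω hω
    rw [llr, hω, ENNReal.toReal_ofReal (Real.exp_pos _).le, Real.log_exp]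
  rw [InformationTheory.klDiv_of_ac_of_integrable hac ((integrable_congr hllr).2 hint),
    integral_congr_ae hllr]
  simp

/-- The Donsker–Varadhan lower bound for the Kullback–Leibler divergence. -/
lemma ofReal_integral_le_klDiv {Ω : Type*} [MeasurableSpace Ω] {μ ν : Measure Ω}
    [IsProbabilityMeasure μ] [IsProbabilityMeasure ν] {F : Ω → ℝ} (hF : Integrable F μ)
    (hexp : Integrable (fun ω => Real.exp (F ω)) ν) (hle : ∫ ω, Real.exp (F ω) ∂ν ≤ 1) :
    ENNReal.ofReal (∫ ω, F ω ∂μ) ≤ InformationTheory.klDiv μ ν := by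
  by_cases h : InformationTheory.klDiv μ ν = ∞
  · simp [h]
  obtain ⟨hac, hint⟩ := InformationTheory.klDiv_ne_top_iff.1 h
  -- With `ν_F` the tilted law, `D(μ‖ν) = D(μ‖ν_F) + ∫ F dμ - log ∫ exp F dν`. The first term is
  -- nonnegative and the logarithm is nonpositive.
  have : IsProbabilityMeasure (ν.tilted F) := isProbabilityMeasure_tilted hexp
  have hac' : μ ≪ ν.tilted F := hac.trans (absolutelyContinuous_tilted hexp)
  have hnonneg := InformationTheory.integral_llr_add_sub_measure_univ_nonneg hac'
    (integrable_llr_tilted_right hac hF hint hexp)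
  rw [integral_llr_tilted_right hac hF hexp hint] at hnonneg
  have hlog : Real.log (∫ ω, Real.exp (F ω) ∂ν) ≤ 0 :=
    Real.log_nonpos (integral_nonneg fun _ => (Real.exp_pos _).le) hle
  rw [InformationTheory.klDiv_of_ac_of_integrable hac hint]
  apply ENNReal.ofReal_le_ofReal
  simp only [probReal_univ] at hnonneg ⊢
  linarith

/-- The mutual information is at most the divergence from any product law with the correct first
marginal. -/
lemma mutualInfo_le_klDiv_prod {S T : Type*} [MeasurableSpace S] [StandardBorelSpace S] [Nonempty S]
    [MeasurableSpace T] (π : Measure (S × T)) [IsProbabilityMeasure π] (Q : Measure T)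
    [IsProbabilityMeasure Q] :
    mutualInfo π ≤ InformationTheory.klDiv π (π.fst.prod Q) := by
  -- Only `S` is standard Borel, so the law is disintegrated over `T` after a swap. The chain rule
  -- then gives `D(π‖π₁ × Q) = D(π₂‖Q) + I(π)`, with `π₁`, `π₂` the marginals.
  have hswap : (π.map Prod.swap).map Prod.swap = π := by
    rw [Measure.map_map measurable_swap measurable_swap]; simp
  have : IsProbabilityMeasure (π.map Prod.swap) :=
    Measure.isProbabilityMeasure_map measurable_swap.aemeasurable
  have hdis := (π.map Prod.swap).disintegrate (π.map Prod.swap).condKernel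
  have hfst : (π.map Prod.swap).fst = π.snd := Measure.fst_map_swap
  rw [hfst] at hdis
  calc mutualInfo π
      = InformationTheory.klDiv ((π.map Prod.swap).map Prod.swap)
          ((π.snd.prod π.fst).map Prod.swap) := by
        rw [hswap, Measure.prod_swap, mutualInfo]
    _ ≤ InformationTheory.klDiv (π.map Prod.swap) (π.snd.prod π.fst) :=
        InformationTheory.klDiv_map_le _ _ measurable_swap
    _ ≤ InformationTheory.klDiv (π.map Prod.swap) (Q.prod π.fst) := by
        rw [← Measure.compProd_const, ← Measure.compProd_const, ← hdis,
          InformationTheory.klDiv_compProd_eq_add _ Q]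
        exact le_add_self
    _ = InformationTheory.klDiv (π.map Prod.swap) ((π.fst.prod Q).map Prod.swap) := by
        rw [Measure.prod_swap]
    _ ≤ _ := InformationTheory.klDiv_map_le _ _ measurable_swap

/-- A product of measures with densities has the product density. -/
lemma pi_withDensity {ι : Type*} [Fintype ι] {E : ι → Type*} [∀ i, MeasurableSpace (E i)]
    (μ : ∀ i, Measure (E i)) [∀ i, IsProbabilityMeasure (μ i)] {f : ∀ i, E i → ℝ≥0∞}
    (hf : ∀ i, Measurable (f i)) [∀ i, IsProbabilityMeasure ((μ i).withDensity (f i))] :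
    Measure.pi (fun i => (μ i).withDensity (f i)) =
      (Measure.pi μ).withDensity fun x => ∏ i, f i (x i) := by
  classical
  refine Measure.pi_eq fun s hs => ?_
  have hprod : ∀ x : ∀ i, E i, (Set.univ.pi s).indicator (fun x => ∏ i, f i (x i)) x =
      ∏ i, (s i).indicator (f i) (x i) := by
    intro x
    by_cases hx : x ∈ Set.univ.pi s
    · rw [Set.indicator_of_mem hx]
      exact Finset.prod_congr rfl fun i _ => (Set.indicator_of_mem (hx i trivial) _).symm
    · rw [Set.indicator_of_notMem hx]
      obtain ⟨i, hi⟩ : ∃ i, x i ∉ s i := by simpa [Set.mem_pi] using hx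
      exact (Finset.prod_eq_zero (Finset.mem_univ i) (Set.indicator_of_notMem hi _)).symm
  have hind : iIndepFun (fun i (x : ∀ i, E i) => (s i).indicator (f i) (x i)) (Measure.pi μ) :=
    iIndepFun_pi fun i => ((hf i).indicator (hs i)).aemeasurable
  rw [withDensity_apply _ (MeasurableSet.univ_pi hs),
    ← lintegral_indicator (MeasurableSet.univ_pi hs)]
  simp_rw [hprod]
  rw [lintegral_prod_eq_prod_lintegral_of_indepFun _ _ hind fun i =>
    ((hf i).indicator (hs i)).comp (measurable_pi_apply i)]
  refine Finset.prod_congr rfl fun i _ => ?_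
  rw [withDensity_apply _ (hs i), ← lintegral_indicator (hs i)]
  exact (measurePreserving_eval μ i).lintegral_comp ((hf i).indicator (hs i))

/-! ### The additive white Gaussian noise channel -/

/-- The density of a Gaussian law of variance one with respect to another Gaussian law. -/
lemma gaussianReal_one_eq_withDensity (a b : ℝ) {v : NNReal} (hv : v ≠ 0) :
    gaussianReal a 1 = (gaussianReal b v).withDensity fun y =>
      ENNReal.ofReal (Real.exp (1 / 2 * Real.log v + (y - b) ^ 2 / (2 * v) - (y - a) ^ 2 / 2)) := by
  rw [gaussianReal_of_var_ne_zero _ hv, gaussianReal_of_var_ne_zero _ one_ne_zero,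
    ← withDensity_mul _ (measurable_gaussianPDF _ _) (by fun_prop)]
  congr 1
  ext y
  have hv' : (0 : ℝ) < v := by positivity
  rw [Pi.mul_apply, gaussianPDF, gaussianPDF, ← ENNReal.ofReal_mul (gaussianPDFReal_nonneg _ _ _)]
  congr 1
  have hlog : Real.exp (1 / 2 * Real.log v) = √v := by
    rw [one_div_mul_eq_div, Real.exp_half, Real.exp_log hv']
  rw [gaussianPDFReal, gaussianPDFReal, sub_eq_add_neg _ ((y - a) ^ 2 / 2), Real.exp_add,
    Real.exp_add, hlog, Real.sqrt_mul (by positivity) (v : ℝ), neg_div (2 * (v : ℝ)), Real.exp_neg]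
  have h1 : √(v : ℝ) ≠ 0 := by positivity
  have h2 : √(2 * Real.pi) ≠ 0 := by positivity
  have h3 := Real.exp_ne_zero ((y - b) ^ 2 / (2 * v))
  simp only [NNReal.coe_one, mul_one]
  rw [neg_div]
  field_simp

instance (m : ℕ) : IsProbabilityMeasure (noiseLaw m) := by unfold noiseLaw; infer_instance

instance (α : unitInterval) (n : ℕ) : IsProbabilityMeasure (sourceLaw α n) := by
  unfold sourceLaw; infer_instance

/-- The joint law of the input and the output of an additive white Gaussian noise channel has a
density with respect to the product of the input law and a product of Gaussian laws. -/
lemma map_add_noise_eq_withDensity {S : Type*} [Countable S] [MeasurableSpace S]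
    [DiscreteMeasurableSpace S] {m : ℕ} (P : Measure S) [IsProbabilityMeasure P]
    (a : S → Fin m → ℝ) (b : Fin m → ℝ) {v : NNReal} (hv : v ≠ 0) :
    (P.prod (noiseLaw m)).map (fun p => (p.1, a p.1 + p.2)) =
      (P.prod (Measure.pi fun i => gaussianReal (b i) v)).withDensity fun z =>
        ENNReal.ofReal (Real.exp (∑ i, (1 / 2 * Real.log v + (z.2 i - b i) ^ 2 / (2 * v) -
          (z.2 i - a z.1 i) ^ 2 / 2))) := by
  have ha : Measurable a := Measurable.of_discrete
  have ha' : ∀ i, Measurable fun z : S × (Fin m → ℝ) => a z.1 i := fun i => by fun_prop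
  have hshift : ∀ x, (noiseLaw m).map (fun w => a x + w) =
      (Measure.pi fun i => gaussianReal (b i) v).withDensity fun y =>
        ENNReal.ofReal (Real.exp (∑ i, (1 / 2 * Real.log v + (y i - b i) ^ 2 / (2 * v) -
          (y i - a x i) ^ 2 / 2))) := by
    intro x
    have h1 : (noiseLaw m).map (fun w => a x + w) =
        Measure.pi fun i => gaussianReal (a x i) 1 := by
      have h := Measure.pi_map_pi (μ := fun _ : Fin m => gaussianReal 0 1)
        (f := fun i w => a x i + w) (fun i => by fun_prop)
      simp only [gaussianReal_map_const_add, zero_add] at h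
      exact h
    have h2 : ∀ i, gaussianReal (a x i) 1 = _ := fun i =>
      gaussianReal_one_eq_withDensity (a x i) (b i) hv
    have : ∀ i, IsProbabilityMeasure ((gaussianReal (b i) v).withDensity fun y =>
        ENNReal.ofReal (Real.exp (1 / 2 * Real.log v + (y - b i) ^ 2 / (2 * v) -
          (y - a x i) ^ 2 / 2))) := fun i => by rw [← h2 i]; infer_instance
    rw [h1]
    simp_rw [h2]
    rw [pi_withDensity _ fun i => by fun_prop]
    congr 1
    ext y
    rw [Real.exp_sum, ENNReal.ofReal_prod_of_nonneg fun _ _ => (Real.exp_pos _).le]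
  ext s hs
  rw [Measure.map_apply (by fun_prop) hs, Measure.prod_apply (hs.preimage (by fun_prop)),
    withDensity_apply _ hs, ← lintegral_indicator hs, lintegral_prod]
  · refine lintegral_congr fun x => ?_
    have hx : MeasurableSet (Prod.mk x ⁻¹' s) := hs.preimage measurable_prodMk_left
    have h := congrArg (fun ν => ν (Prod.mk x ⁻¹' s)) (hshift x)
    beta_reduce at h
    rw [Measure.map_apply (by fun_prop) hx, withDensity_apply _ hx, ← lintegral_indicator hx] at h
    exact h
  · refine Measurable.aemeasurable (Measurable.indicator ?_ hs)
    fun_prop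

/-- The divergence of the joint law of the input and the output of an additive white Gaussian noise
channel from the product of the input law and the Gaussian output law of variance `v`, if the
signal has power at most `v - 1`. -/
lemma klDiv_map_add_noise_le {S : Type*} [Finite S] [MeasurableSpace S]
    [DiscreteMeasurableSpace S] {m : ℕ} (P : Measure S) [IsProbabilityMeasure P]
    (a : S → Fin m → ℝ) (b : Fin m → ℝ) {v : NNReal} (hv : v ≠ 0)
    (hpow : ∀ i, ∫ x, (a x i - b i) ^ 2 ∂P ≤ v - 1) :
    InformationTheory.klDiv ((P.prod (noiseLaw m)).map fun p => (p.1, a p.1 + p.2))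
      (P.prod (Measure.pi fun i => gaussianReal (b i) v)) ≤
        ENNReal.ofReal (m / 2 * Real.log v) := by
  have ha : Measurable a := Measurable.of_discrete
  have ha' : ∀ i, Measurable fun z : S × (Fin m → ℝ) => a z.1 i := fun i => by fun_prop
  have hmap : Measurable fun p : S × (Fin m → ℝ) => (p.1, a p.1 + p.2) := by fun_prop
  have hv' : (0 : ℝ) < v := by positivity
  have : IsProbabilityMeasure ((P.prod (noiseLaw m)).map fun p => (p.1, a p.1 + p.2)) :=
    Measure.isProbabilityMeasure_map hmap.aemeasurable
  set L : S × (Fin m → ℝ) → ℝ := fun z => ∑ i, (1 / 2 * Real.log v +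
    (z.2 i - b i) ^ 2 / (2 * v) - (z.2 i - a z.1 i) ^ 2 / 2) with hLdef
  have hL : Measurable L := by fun_prop
  have hcoord : ∀ i, MemLp (fun w : Fin m → ℝ => w i) 2 (noiseLaw m) := fun i =>
    (memLp_id_gaussianReal (μ := 0) (v := 1) 2).comp_measurePreserving
      (measurePreserving_eval (fun _ : Fin m => gaussianReal 0 1) i)
  have hw1 : ∀ i, ∫ w, w i ∂noiseLaw m = 0 := fun i => by
    have h := (measurePreserving_eval (fun _ : Fin m => gaussianReal 0 1) i).map_eq
    have h' := integral_map (μ := noiseLaw m) (φ := Function.eval i) (f := fun y : ℝ => y)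
      (measurable_pi_apply i).aemeasurable
      (by fun_prop)
    rw [noiseLaw, h] at h'
    rw [integral_id_gaussianReal] at h'
    exact h'.symm
  have hw2 : ∀ i, ∫ w, w i ^ 2 ∂noiseLaw m = 1 := fun i => by
    have h := (measurePreserving_eval (fun _ : Fin m => gaussianReal 0 1) i).map_eq
    have h' := integral_map (μ := noiseLaw m) (φ := Function.eval i) (f := fun y : ℝ => y ^ 2)
      (measurable_pi_apply i).aemeasurable
      (by fun_prop)
    have hvar := variance_id_gaussianReal (μ := 0) (v := 1)
    rw [variance_of_integral_eq_zero (by fun_prop) (by simp)] at hvar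
    rw [noiseLaw, h] at h'
    simpa [noiseLaw] using h'.symm.trans hvar
  have hS : ∀ f : S → ℝ, Integrable f P := fun f => .of_finite
  -- After substituting `y = a + w`, the cross term vanishes because the noise is centred and
  -- independent of the input. The two quadratic terms have means at most `((v - 1) + 1)/(2v) = 1/2`
  -- and exactly `1/2`, so only the normalizing constant `1/2 · log v` survives.
  have hterm : ∀ i, Integrable (fun p : S × (Fin m → ℝ) => 1 / 2 * Real.log v +
        ((a p.1 i - b i) ^ 2 + 2 * ((a p.1 i - b i) * p.2 i) + p.2 i ^ 2) / (2 * v) -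
        p.2 i ^ 2 / 2) (P.prod (noiseLaw m)) ∧
      ∫ p, (1 / 2 * Real.log v +
        ((a p.1 i - b i) ^ 2 + 2 * ((a p.1 i - b i) * p.2 i) + p.2 i ^ 2) / (2 * v) -
        p.2 i ^ 2 / 2) ∂(P.prod (noiseLaw m)) ≤ 1 / 2 * Real.log v := by
    intro i
    have i1 : Integrable (fun p : S × (Fin m → ℝ) => (a p.1 i - b i) ^ 2)
      (P.prod (noiseLaw m)) := (hS fun x => (a x i - b i) ^ 2).comp_fst _
    have i2 : Integrable (fun p : S × (Fin m → ℝ) => (a p.1 i - b i) * p.2 i)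
      (P.prod (noiseLaw m)) :=
      (hS fun x => a x i - b i).mul_prod ((hcoord i).integrable one_le_two)
    have i3 : Integrable (fun p : S × (Fin m → ℝ) => p.2 i ^ 2)
      (P.prod (noiseLaw m)) := (hcoord i).integrable_sq.comp_snd _
    have i12 : Integrable (fun p : S × (Fin m → ℝ) => (a p.1 i - b i) ^ 2 +
        2 * ((a p.1 i - b i) * p.2 i)) (P.prod (noiseLaw m)) := i1.add (i2.const_mul 2)
    have i4 : Integrable (fun p : S × (Fin m → ℝ) => (a p.1 i - b i) ^ 2 +
        2 * ((a p.1 i - b i) * p.2 i) + p.2 i ^ 2) (P.prod (noiseLaw m)) :=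
      i12.add i3
    have i5 : Integrable (fun p : S × (Fin m → ℝ) => 1 / 2 * Real.log v +
        ((a p.1 i - b i) ^ 2 + 2 * ((a p.1 i - b i) * p.2 i) + p.2 i ^ 2) / (2 * v))
        (P.prod (noiseLaw m)) := (integrable_const _).add (i4.div_const (2 * v))
    refine ⟨i5.sub (i3.div_const 2), ?_⟩
    have e1 : ∫ p : S × (Fin m → ℝ), (a p.1 i - b i) ^ 2 ∂(P.prod (noiseLaw m)) =
        ∫ x, (a x i - b i) ^ 2 ∂P := by
      rw [integral_prod _ i1]; simp
    have e2 : ∫ p : S × (Fin m → ℝ), (a p.1 i - b i) * p.2 i ∂(P.prod (noiseLaw m)) = 0 := by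
      rw [integral_prod_mul (fun x => a x i - b i) (fun w : Fin m → ℝ => w i), hw1, mul_zero]
    have e3 : ∫ p : S × (Fin m → ℝ), p.2 i ^ 2 ∂(P.prod (noiseLaw m)) = 1 := by
      rw [integral_prod _ i3]; simp [hw2]
    rw [integral_sub i5 (i3.div_const 2), integral_add (integrable_const _) (i4.div_const _),
      integral_div, integral_div, integral_add i12 i3,
      integral_add i1 (i2.const_mul 2), integral_const_mul 2, e1, e2, e3]
    have := hpow i
    have h2 : (∫ x, (a x i - b i) ^ 2 ∂P + 2 * 0 + 1) / (2 * v) ≤ 1 / 2 := by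
      rw [div_le_iff₀ (by positivity)]; linarith
    simp only [integral_const, probReal_univ, one_smul]
    linarith
  have hcomp : ∀ p : S × (Fin m → ℝ), L (p.1, a p.1 + p.2) = ∑ i, (1 / 2 * Real.log v +
        ((a p.1 i - b i) ^ 2 + 2 * ((a p.1 i - b i) * p.2 i) + p.2 i ^ 2) / (2 * v) -
        p.2 i ^ 2 / 2) := by
    intro p
    simp only [hLdef, Pi.add_apply]
    refine Finset.sum_congr rfl fun i _ => ?_
    congr 2
    · congr 1; ring
    · ring
  have hLint : Integrable L ((P.prod (noiseLaw m)).map fun p => (p.1, a p.1 + p.2)) := by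
    rw [integrable_map_measure hL.aestronglyMeasurable hmap.aemeasurable]
    simp only [Function.comp_def, hcomp]
    exact integrable_finsetSum _ fun i _ => (hterm i).1
  rw [klDiv_eq_of_withDensity_exp hL (map_add_noise_eq_withDensity P a b hv) hLint]
  apply ENNReal.ofReal_le_ofReal
  rw [integral_map hmap.aemeasurable hL.aestronglyMeasurable]
  simp only [hcomp]
  rw [integral_finsetSum _ fun i _ => (hterm i).1]
  calc _ ≤ ∑ _i : Fin m, 1 / 2 * Real.log v := Finset.sum_le_sum fun i _ => (hterm i).2
    _ = m / 2 * Real.log v := by simp; ring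

/-! ### Mutual information for a given sensing matrix -/

lemma measurable_observe (SNR : ℝ) {Ω : Type*} [MeasurableSpace Ω] {m n : ℕ}
    {G : Ω → Fin m → Fin n → ℝ} {x : Ω → Fin n → Bool} {w : Ω → Fin m → ℝ} (hG : Measurable G)
    (hx : Measurable x) (hw : Measurable w) :
    Measurable fun ω => observe SNR (G ω) (x ω) (w ω) := by
  have hb : ∀ j, Measurable fun ω => if x ω j then (1 : ℝ) else 0 := fun j =>
    (Measurable.of_discrete (f := fun b : Bool => if b then (1 : ℝ) else 0)).comp
      ((measurable_pi_apply j).comp hx)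
  unfold observe
  fun_prop

instance {α : unitInterval} {SNR : ℝ} {m n : ℕ} (G : Fin m → Fin n → ℝ) :
    IsProbabilityMeasure (jointLaw α SNR G) := by
  exact Measure.isProbabilityMeasure_map
    (measurable_fst.prodMk (measurable_observe SNR measurable_const measurable_fst
      measurable_snd)).aemeasurable

lemma jointLaw_fst (α : unitInterval) (SNR : ℝ) {m n : ℕ} (G : Fin m → Fin n → ℝ) :
    (jointLaw α SNR G).fst = sourceLaw α n := by
  rw [jointLaw, Measure.fst_map_prodMk (measurable_observe SNR measurable_const measurable_fst
    measurable_snd)]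
  exact Measure.fst_prod

/-- The mean power of a centered linear combination of independent Bernoulli variables. -/
lemma integral_signal_sub_mean_sq (α : unitInterval) {SNR : ℝ} (hSNR : 0 ≤ SNR) {n : ℕ}
    (g : Fin n → ℝ) :
    ∫ x, (√SNR * ∑ j, g j * (if x j then 1 else 0) -
      ∫ x, √SNR * ∑ j, g j * (if x j then 1 else 0) ∂sourceLaw α n) ^ 2 ∂sourceLaw α n =
      SNR * (α * (1 - α)) * ∑ j, g j ^ 2 := by
  have hvar : ∀ j, Var[fun b : Bool => g j * (if b then (1 : ℝ) else 0);
      bernoulliMeasure true false α] = α * (1 - α) * g j ^ 2 := fun j => by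
    rw [variance_eq_integral (by fun_prop), integral_bernoulliMeasure, integral_bernoulliMeasure]
    simp
    ring
  have hsum : Var[∑ j, fun x : Fin n → Bool => g j * (if x j then (1 : ℝ) else 0);
      sourceLaw α n] = ∑ j, α * (1 - α) * g j ^ 2 := by
    rw [sourceLaw, variance_sum_pi (X := fun j (b : Bool) => g j * (if b then (1 : ℝ) else 0))
      fun j => .of_discrete]
    exact Finset.sum_congr rfl fun j _ => hvar j
  rw [← variance_eq_integral (by fun_prop), variance_const_mul, Real.sq_sqrt hSNR, mul_assoc,
    Finset.mul_sum, ← hsum]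
  congr 2
  ext x
  simp

/-- For every sensing matrix whose rows have norm at most one, the mutual information between the
signal and the observation is at most the capacity of `m` Gaussian channels. -/
lemma mutualInfo_jointLaw_le (α : unitInterval) {SNR : ℝ} (hSNR : 0 ≤ SNR) {m n : ℕ}
    (G : Fin m → Fin n → ℝ) (hG : ∀ i, ∑ j, G i j ^ 2 ≤ 1) :
    mutualInfo (jointLaw α SNR G) ≤ ENNReal.ofReal ((m : ℝ) / 2 * Real.log (1 + α * SNR)) := by
  have hα := α.2.1
  have hα1 := α.2.2
  have hαS : 0 ≤ (α : ℝ) * SNR := by positivity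
  have hcoe : ((1 + α * SNR).toNNReal : ℝ) = 1 + α * SNR := Real.coe_toNNReal _ (by linarith)
  have hv : (1 + α * SNR : ℝ).toNNReal ≠ 0 := by
    rw [ne_eq, ← NNReal.coe_eq_zero, hcoe]; positivity
  -- Centring the reference law at the mean output leaves only the variance `SNR α (1 - α) ∑ j, G i
  -- j ^ 2` to bound; the factor `1 - α` is then discarded.
  refine (mutualInfo_le_klDiv_prod _ (Measure.pi fun i => gaussianReal
    (∫ x, √SNR * ∑ j, G i j * (if x j then 1 else 0) ∂sourceLaw α n)
    (1 + α * SNR : ℝ).toNNReal)).trans ?_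
  rw [jointLaw_fst]
  refine (klDiv_map_add_noise_le (sourceLaw α n)
    (fun x i => √SNR * ∑ j, G i j * (if x j then 1 else 0)) _ hv fun i => ?_).trans_eq
    (by rw [hcoe])
  rw [integral_signal_sub_mean_sq α hSNR, hcoe]
  have h0 : 0 ≤ ∑ j, G i j ^ 2 := Finset.sum_nonneg fun _ _ => sq_nonneg _
  have h1 : SNR * (α * (1 - α)) ≤ SNR * α :=
    mul_le_mul_of_nonneg_left (by nlinarith) hSNR
  have h2 : 0 ≤ SNR * α := by positivity
  nlinarith [hG i]

instance : IsProbabilityMeasure (entryLaw 1) := by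
  have : entryLaw 1 = gaussianReal 0 1 := by simp [entryLaw]
  rw [this]; infer_instance

lemma measurable_normalizeRows {m n : ℕ} : Measurable (normalizeRows (m := m) (n := n)) := by
  unfold normalizeRows
  fun_prop

instance (m n : ℕ) : IsProbabilityMeasure (gaussianEnsemble 1 m n) :=
  Measure.isProbabilityMeasure_map measurable_normalizeRows.aemeasurable

/-- Equality fails for a zero row, which stays zero because division by zero gives zero. The
inequality holds for every matrix and suffices. -/
lemma sum_normalizeRows_sq_le {m n : ℕ} (A : Fin m → Fin n → ℝ) (i : Fin m) :
    ∑ j, normalizeRows A i j ^ 2 ≤ 1 := by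
  have h0 : 0 ≤ ∑ k, A i k ^ 2 := Finset.sum_nonneg fun _ _ => sq_nonneg _
  simp only [normalizeRows, div_pow, Real.sq_sqrt h0]
  rw [← Finset.sum_div]
  exact div_self_le_one _

lemma ae_gaussianEnsemble_sum_sq_le (m n : ℕ) :
    ∀ᵐ G ∂gaussianEnsemble 1 m n, ∀ i, ∑ j, G i j ^ 2 ≤ 1 := by
  refine (ae_map_iff measurable_normalizeRows.aemeasurable ?_).2
    (Eventually.of_forall fun A => sum_normalizeRows_sq_le A)
  rw [Set.ofPred_forall]
  exact MeasurableSet.iInter fun i => measurableSet_le (by fun_prop) (by fun_prop)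

lemma expectedMutualInfo_le (α : unitInterval) {SNR : ℝ} (hSNR : 0 ≤ SNR) (m n : ℕ) :
    expectedMutualInfo α 1 SNR m n ≤ ENNReal.ofReal ((m : ℝ) / 2 * Real.log (1 + α * SNR)) :=
  calc expectedMutualInfo α 1 SNR m n
      ≤ ∫⁻ _, ENNReal.ofReal ((m : ℝ) / 2 * Real.log (1 + α * SNR)) ∂gaussianEnsemble 1 m n :=
        lintegral_mono_ae ((ae_gaussianEnsemble_sum_sq_le m n).mono fun G hG =>
          mutualInfo_jointLaw_le α hSNR G hG)
    _ = _ := by simp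

/-! ### The rate distortion function of a Bernoulli source -/

lemma lintegral_bernoulliMeasure_bool (p : unitInterval) (f : Bool → ℝ≥0∞) :
    ∫⁻ b, f b ∂bernoulliMeasure true false p =
      ENNReal.ofReal p * f true + ENNReal.ofReal (1 - p) * f false := by
  have h1 : ((unitInterval.toNNReal p : NNReal) : ℝ≥0∞) = ENNReal.ofReal p := by
    rw [← ENNReal.ofReal_coe_nnreal]; simp
  have h2 : ((unitInterval.toNNReal (unitInterval.symm p) : NNReal) : ℝ≥0∞) =
      ENNReal.ofReal (1 - p) := by
    rw [← ENNReal.ofReal_coe_nnreal]; simp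
  rw [bernoulliMeasure_def, lintegral_add_measure]
  simp [ENNReal.smul_def, h1, h2]

/-- The probability that a Bernoulli variable of parameter `α` takes a given value. -/
noncomputable def bernoulliProb (α : ℝ) (x : Bool) : ℝ := if x then α else 1 - α

/-- The ratio between the law at `x` of the output of a binary symmetric channel with crossover
probability `D` and input `y`, and the Bernoulli law of parameter `α`. -/
noncomputable def backwardRatio (α D : ℝ) (x y : Bool) : ℝ :=
  (if x = y then 1 - D else D) / bernoulliProb α x

/-- The rate distortion function of a Bernoulli source is at most the difference of the entropies of
the source and of the distortion level. -/
lemma rateDistortion_bernoulli_le (α : unitInterval) {D : ℝ} (hα0 : 0 < (α : ℝ))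
    (hα : (α : ℝ) ≤ 1 / 2) (hD0 : 0 ≤ D) (hD : D ≤ α) :
    rateDistortion (bernoulliMeasure true false α) hamming D ≤
      ENNReal.ofReal (Real.binEntropy α - Real.binEntropy D) := by
  -- `q` solves `q (1 - D) + (1 - q) D = α`, so that a Bernoulli(`q`) reconstruction sent through
  -- the symmetric channel has law Bernoulli(`α`). If `D = 1/2` then `α = 1/2` and any `q` works.
  obtain ⟨q, hq⟩ : ∃ q : unitInterval, (q : ℝ) * (1 - 2 * D) = α - D := by
    rcases eq_or_ne D (1 / 2) with h | h
    · exact ⟨0, by subst h; norm_num; linarith⟩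
    · have hlt : 0 < 1 - 2 * D := by
        have : D < 1 / 2 := lt_of_le_of_ne (hD.trans hα) h
        linarith
      exact ⟨⟨(α - D) / (1 - 2 * D), div_nonneg (by linarith) hlt.le,
        (div_le_one hlt).2 (by linarith)⟩, div_mul_cancel₀ _ hlt.ne'⟩
  have hα1 : 0 < 1 - (α : ℝ) := by linarith
  have hq0 := q.2.1
  have hq1 : 0 ≤ 1 - (q : ℝ) := sub_nonneg.2 q.2.2
  have hD1 : 0 ≤ 1 - D := by linarith
  set P : Measure Bool := bernoulliMeasure true false α with hP
  set Q : Measure Bool := bernoulliMeasure true false q with hQ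
  set f : Bool × Bool → ℝ := fun z => backwardRatio α D z.1 z.2 with hf
  have hf0 : ∀ z, 0 ≤ f z := by
    rintro ⟨x, y⟩
    cases x <;> cases y <;> simp [hf, backwardRatio, bernoulliProb] <;> positivity
  have hfm : Measurable f := .of_discrete
  -- The backward test channel: `X` is `X̂` with its bit flipped with probability `D`. The equation
  -- for `q` yields the first marginal.
  set π : Measure (Bool × Bool) := (P.prod Q).withDensity fun z => ENNReal.ofReal (f z) with hπ
  have hlint : ∀ g : Bool × Bool → ℝ≥0∞, ∫⁻ z, g z ∂π =
      ∫⁻ x, ∫⁻ y, ENNReal.ofReal (f (x, y)) * g (x, y) ∂Q ∂P := fun g => by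
    rw [hπ, lintegral_withDensity_eq_lintegral_mul _ (by fun_prop) .of_discrete,
      lintegral_prod _ (Measurable.of_discrete).aemeasurable]
    rfl
  have hfst : π.fst = P := by
    ext s hs
    have hrow : ∀ x, ∫⁻ y, ENNReal.ofReal (f (x, y)) ∂Q = 1 := by
      intro x
      rw [hQ, lintegral_bernoulliMeasure_bool, ← ENNReal.ofReal_mul hq0, ← ENNReal.ofReal_mul hq1,
        ← ENNReal.ofReal_add (mul_nonneg hq0 (hf0 _)) (mul_nonneg hq1 (hf0 _)),
        ← ENNReal.ofReal_one]
      congr 1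
      cases x <;> simp [hf, backwardRatio, bernoulliProb] <;> field_simp <;> linarith
    rw [Measure.fst_apply hs, ← lintegral_indicator_one (hs.preimage measurable_fst), hlint,
      ← lintegral_indicator_one hs]
    refine lintegral_congr fun x => ?_
    by_cases hx : x ∈ s
    · simp [Set.indicator, hx, hrow]
    · simp [Set.indicator, hx]
  have hcol : ∀ y, ∫⁻ x, ENNReal.ofReal (f (x, y)) ∂P = 1 := by
    intro y
    rw [hP, lintegral_bernoulliMeasure_bool, ← ENNReal.ofReal_mul hα0.le,
      ← ENNReal.ofReal_mul hα1.le,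
      ← ENNReal.ofReal_add (mul_nonneg hα0.le (hf0 _)) (mul_nonneg hα1.le (hf0 _)),
      ← ENNReal.ofReal_one]
    congr 1
    cases y <;> simp [hf, backwardRatio, bernoulliProb] <;> field_simp <;> linarith
  have hsnd : π.snd = Q := by
    ext s hs
    rw [Measure.snd_apply hs, ← lintegral_indicator_one (hs.preimage measurable_snd), hlint,
      lintegral_lintegral_swap (Measurable.of_discrete).aemeasurable,
      ← lintegral_indicator_one hs]
    refine lintegral_congr fun y => ?_
    by_cases hy : y ∈ s
    · simp [Set.indicator, hy, hcol]
    · simp [Set.indicator, hy]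
  have hprob : IsProbabilityMeasure π := by
    constructor
    rw [← Measure.fst_univ, hfst]
    exact measure_univ
  have hdist : ∫⁻ z, ENNReal.ofReal (hamming z.1 z.2) ∂π ≤ ENNReal.ofReal D := by
    rw [hlint, hP, hQ]
    simp only [lintegral_bernoulliMeasure_bool]
    simp only [hf, backwardRatio, bernoulliProb, hamming]
    simp only [if_true, Bool.true_eq_false, Bool.false_eq_true, if_false, ENNReal.ofReal_zero,
      ENNReal.ofReal_one, mul_zero, mul_one, zero_add, add_zero]
    rw [← ENNReal.ofReal_mul hq1, ← ENNReal.ofReal_mul hq0, ← ENNReal.ofReal_mul hα0.le,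
      ← ENNReal.ofReal_mul hα1.le, ← ENNReal.ofReal_add (by positivity) (by positivity)]
    refine le_of_eq (congrArg _ ?_)
    field_simp
    ring
  have hac : π ≪ P.prod Q := withDensity_absolutelyContinuous _ _
  have hrn : π.rnDeriv (P.prod Q) =ᵐ[P.prod Q] fun z => ENNReal.ofReal (f z) :=
    Measure.rnDeriv_withDensity _ (by fun_prop)
  refine (iInf_le_of_le π (iInf_le_of_le hfst (iInf_le_of_le hdist ?_)))
  rw [mutualInfo, hfst, hsnd, InformationTheory.klDiv_eq_integral_klFun,
    if_pos ⟨hac, Integrable.of_finite⟩]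
  apply ENNReal.ofReal_le_ofReal
  have hcongr : (fun z => InformationTheory.klFun (π.rnDeriv (P.prod Q) z).toReal) =ᵐ[P.prod Q]
      fun z => InformationTheory.klFun (f z) := hrn.mono fun z hz => by
    simp only [hz, ENNReal.toReal_ofReal (hf0 z)]
  rw [integral_congr_ae hcongr, integral_prod _ Integrable.of_finite, hP, hQ]
  -- The case `u = 0` occurs when `D = 0`; it agrees with the convention `0 log 0 = 0`.
  have hlogmul : ∀ u p : ℝ, p ≠ 0 → u / p * Real.log (u / p) =
      (u * Real.log u - u * Real.log p) / p := fun u p hp => by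
    rcases eq_or_ne u 0 with rfl | hu
    · simp
    · rw [Real.log_div hu hp]; ring
  simp only [integral_bernoulliMeasure, hf, backwardRatio, bernoulliProb, InformationTheory.klFun,
    smul_eq_mul]
  simp only [if_true, Bool.true_eq_false, Bool.false_eq_true, if_false]
  rw [hlogmul _ _ hα0.ne', hlogmul _ _ hα0.ne', hlogmul _ _ hα1.ne', hlogmul _ _ hα1.ne',
    Real.binEntropy, Real.binEntropy]
  simp only [Real.log_inv]
  -- The remaining identity is linear in the four logarithms, so they can be treated as free
  -- variables.
  generalize Real.log (α : ℝ) = a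
  generalize Real.log (1 - (α : ℝ)) = b
  generalize Real.log D = c
  generalize Real.log (1 - D) = d
  field_simp
  have hαq : (α : ℝ) = q * (1 - 2 * D) + D := by linarith
  apply le_of_eq
  rw [hαq]
  ring

/-! ### Lower bound for the mutual information from a reconstruction -/

lemma exp_log_backwardRatio {α D : ℝ} (hα0 : 0 < α) (hα1 : α < 1) (hD0 : 0 < D) (hD1 : D < 1)
    (x y : Bool) : Real.exp (Real.log (backwardRatio α D x y)) = backwardRatio α D x y := by
  have h1 : 0 < 1 - α := by linarith
  have h2 : 0 < 1 - D := by linarith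
  apply Real.exp_log
  cases x <;> cases y <;> simp [backwardRatio, bernoulliProb] <;> positivity

/-- The symmetric channel only sees whether `x = y`, so the mean of the test function depends on the
reconstruction only through the mean distortion. -/
lemma log_backwardRatio {α D : ℝ} (hα0 : 0 < α) (hα1 : α < 1) (hD0 : 0 < D) (hD1 : D < 1)
    (x y : Bool) : Real.log (backwardRatio α D x y) =
      -Real.log (bernoulliProb α x) + Real.log (1 - D) -
        (Real.log (1 - D) - Real.log D) * hamming x y := by
  have h1 : 1 - α ≠ 0 := by linarith
  have h2 : 1 - D ≠ 0 := by linarith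
  cases x <;> cases y <;> simp [backwardRatio, bernoulliProb, hamming] <;>
    rw [Real.log_div (by positivity) (by positivity)] <;> ring

/-- For each fixed `y`, the product of the channel laws is a probability law in `x`. This is the
normalization required by Donsker–Varadhan, whatever the law of the reconstruction. -/
lemma integral_exp_sum_log_backwardRatio (α : unitInterval) {D : ℝ} (hα0 : 0 < (α : ℝ))
    (hα1 : (α : ℝ) < 1) (hD0 : 0 < D) (hD1 : D < 1) {n : ℕ} (y : Fin n → Bool) :
    ∫ x, Real.exp (∑ j, Real.log (backwardRatio α D (x j) (y j))) ∂sourceLaw α n = 1 := by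
  simp only [Real.exp_sum, exp_log_backwardRatio hα0 hα1 hD0 hD1]
  rw [sourceLaw, integral_fintype_prod_eq_prod fun j b => backwardRatio α D b (y j)]
  refine Finset.prod_eq_one fun j _ => ?_
  have h1 : 1 - (α : ℝ) ≠ 0 := by linarith
  rw [integral_bernoulliMeasure]
  cases y j <;> simp [backwardRatio, bernoulliProb] <;> field_simp <;> ring

lemma integrable_comp_finite {Ω E : Type*} [MeasurableSpace Ω] {μ : Measure Ω} [IsFiniteMeasure μ]
    [Finite E] [MeasurableSpace E] [DiscreteMeasurableSpace E] (h : E → ℝ) {k : Ω → E}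
    (hk : Measurable k) : Integrable (fun ω => h (k ω)) μ :=
  (Integrable.of_finite (μ := μ.map k) (f := h)).comp_measurable hk

/-- A lower bound for the mutual information between the signal and an observation in terms of a
reconstruction based on this observation. -/
lemma ofReal_integral_le_mutualInfo {T : Type*} [MeasurableSpace T] (α : unitInterval) {D : ℝ}
    (hα0 : 0 < (α : ℝ)) (hα1 : (α : ℝ) < 1) (hD0 : 0 < D) (hD1 : D < 1) {n : ℕ}
    (π : Measure ((Fin n → Bool) × T)) [IsProbabilityMeasure π] (hπ : π.fst = sourceLaw α n)
    {r : T → Fin n → Bool} (hr : Measurable r) :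
    ENNReal.ofReal (∫ z, ∑ j, Real.log (backwardRatio α D (z.1 j) (r z.2 j)) ∂π) ≤
      mutualInfo π := by
  have hk : Measurable fun z : (Fin n → Bool) × T => (z.1, r z.2) := by fun_prop
  have hint := fun (μ : Measure ((Fin n → Bool) × T)) [IsFiniteMeasure μ]
      (h : (Fin n → Bool) × (Fin n → Bool) → ℝ) => integrable_comp_finite (μ := μ) h hk
  have hexp := hint (π.fst.prod π.snd)
    fun p => Real.exp (∑ j, Real.log (backwardRatio α D (p.1 j) (p.2 j)))
  refine ofReal_integral_le_klDiv
    (hint π fun p => ∑ j, Real.log (backwardRatio α D (p.1 j) (p.2 j))) hexp ?_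
  rw [integral_prod_symm _ hexp, hπ]
  simp [integral_exp_sum_log_backwardRatio α hα0 hα1 hD0 hD1]

lemma integral_sum_neg_log_bernoulliProb (α : unitInterval) (n : ℕ) :
    ∫ x, ∑ j, -Real.log (bernoulliProb α (x j)) ∂sourceLaw α n = n * Real.binEntropy α := by
  rw [integral_finsetSum _ fun _ _ => Integrable.of_finite]
  have h : ∀ j, ∫ x, -Real.log (bernoulliProb α (x j)) ∂sourceLaw α n = Real.binEntropy α := by
    intro j
    have hmap := (measurePreserving_eval (fun _ : Fin n => bernoulliMeasure true false α) j).map_eq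
    have h' := integral_map (μ := sourceLaw α n) (φ := Function.eval j)
      (f := fun b : Bool => -Real.log (bernoulliProb α b))
      (measurable_pi_apply j).aemeasurable (Measurable.of_discrete).aestronglyMeasurable
    rw [sourceLaw, hmap, integral_bernoulliMeasure] at h'
    simp only [Function.eval] at h'
    rw [sourceLaw, ← h', Real.binEntropy]
    simp [bernoulliProb]
  simp [h]

/-! ### The converse at finite length -/

/-- Brings the sensing matrix outermost, so that signal and noise can be integrated with the matrix
fixed. -/
lemma measurePreserving_prod_left_comm {X Y Z : Type*} [MeasurableSpace X] [MeasurableSpace Y]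
    [MeasurableSpace Z] (μ : Measure X) (ν : Measure Y) (ρ : Measure Z) [SFinite μ]
    [SFinite ν] [SFinite ρ] :
    MeasurePreserving (fun p : Y × X × Z => (p.2.1, p.1, p.2.2)) (ν.prod (μ.prod ρ))
      (μ.prod (ν.prod ρ)) :=
  ((measurePreserving_prodAssoc μ ν ρ).comp
    (Measure.measurePreserving_swap.prod (MeasurePreserving.id ρ))).comp
    ((measurePreserving_prodAssoc ν μ ρ).symm)

/-- Every reconstruction from `m` measurements with error probability `e` needs
`m` to be at least of the order of the rate distortion function. -/
lemma rate_le_of_errorProb (α : unitInterval) {SNR d₀ D : ℝ} (hα0 : 0 < (α : ℝ))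
    (hα1 : (α : ℝ) < 1) (hSNR : 0 ≤ SNR) (hd₀ : 0 ≤ d₀) (hD0 : 0 < D) (hD1 : D ≤ 1 / 2) {m n : ℕ}
    {Xhat : (Fin m → Fin n → ℝ) × (Fin m → ℝ) → (Fin n → Bool)} (hX : Measurable Xhat) :
    n * (Real.binEntropy α + Real.log (1 - D) - (Real.log (1 - D) - Real.log D) *
      (d₀ + (errorProb α 1 SNR d₀ m n Xhat).toReal)) ≤
      m * (1 / 2 * Real.log (1 + α * SNR)) := by
  have hD1' : D < 1 := by linarith
  set E := gaussianEnsemble 1 m n with hE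
  set P := sourceLaw α n with hP
  set N := noiseLaw m with hN
  set τ := P.prod (E.prod N) with hτ
  let k : (Fin n → Bool) × (Fin m → Fin n → ℝ) × (Fin m → ℝ) → (Fin n → Bool) × (Fin n → Bool) :=
    fun ω => (ω.1, Xhat (ω.2.1, observe SNR ω.2.1 ω.1 ω.2.2))
  have hk : Measurable k := by
    refine measurable_fst.prodMk (hX.comp ((by fun_prop : Measurable fun ω :
      (Fin n → Bool) × (Fin m → Fin n → ℝ) × (Fin m → ℝ) => ω.2.1).prodMk ?_))
    exact measurable_observe SNR (by fun_prop) (by fun_prop) (by fun_prop)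
  let F : (Fin n → Bool) × (Fin n → Bool) → ℝ :=
    fun p => ∑ j, Real.log (backwardRatio α D (p.1 j) (p.2 j))
  let H : (Fin n → Bool) × (Fin n → Bool) → ℝ := fun p => ∑ j, hamming (p.1 j) (p.2 j)
  set B := Real.log (1 - D) - Real.log D with hB
  -- `D ≤ 1/2` makes the slope nonnegative, so an upper bound on the distortion bounds the mean of
  -- the test function from below.
  have hB0 : 0 ≤ B := sub_nonneg.2 (Real.log_le_log hD0 (by linarith))
  have hc0 : 0 ≤ Real.log (1 + α * SNR) := Real.log_nonneg (by nlinarith)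
  have hτint : ∀ h : (Fin n → Bool) × (Fin n → Bool) → ℝ, Integrable (fun ω => h (k ω)) τ :=
    fun h => integrable_comp_finite h hk
  have hupper : ∫ ω, F (k ω) ∂τ ≤ m * (1 / 2 * Real.log (1 + α * SNR)) := by
    have hmp := measurePreserving_prod_left_comm P E N
    have hFm : Measurable fun ω => F (k ω) := (Measurable.of_discrete (f := F)).comp hk
    have hint' : Integrable (fun p : (Fin m → Fin n → ℝ) × (Fin n → Bool) × (Fin m → ℝ) =>
        F (k (p.2.1, p.1, p.2.2))) (E.prod (P.prod N)) := hmp.integrable_comp_of_integrable (hτint F)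
    rw [hτ, ← hmp.map_eq, integral_map hmp.measurable.aemeasurable hFm.aestronglyMeasurable,
      integral_prod _ hint']
    have hG : ∀ᵐ G ∂E, ∫ p : (Fin n → Bool) × (Fin m → ℝ), F (k (p.1, G, p.2)) ∂(P.prod N) ≤
        m * (1 / 2 * Real.log (1 + α * SNR)) := by
      filter_upwards [ae_gaussianEnsemble_sum_sq_le m n] with G hG
      have hr : Measurable fun y => Xhat (G, y) := hX.comp measurable_prodMk_left
      have h := (ofReal_integral_le_mutualInfo α hα0 hα1 hD0 hD1' (jointLaw α SNR G)
        (jointLaw_fst α SNR G) hr).trans (mutualInfo_jointLaw_le α hSNR G hG)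
      have hm : Measurable fun z : (Fin n → Bool) × (Fin m → ℝ) =>
          ∑ j, Real.log (backwardRatio α D (z.1 j) (Xhat (G, z.2) j)) :=
        (Measurable.of_discrete (f := F)).comp (measurable_fst.prodMk (hr.comp measurable_snd))
      rw [jointLaw, integral_map (measurable_fst.prodMk (measurable_observe SNR measurable_const
        measurable_fst measurable_snd)).aemeasurable hm.aestronglyMeasurable,
        ENNReal.ofReal_le_ofReal_iff (by positivity)] at h
      refine h.trans_eq ?_
      ring
    refine (integral_mono_ae hint'.integral_prod_left (integrable_const _) hG).trans_eq ?_
    simp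
  have hham : ∫ ω, H (k ω) ∂τ ≤ n * (d₀ + (errorProb α 1 SNR d₀ m n Xhat).toReal) := by
    set s := {ω | d₀ < (1 / (n : ℝ)) * H (k ω)} with hs
    have hsm : MeasurableSet s := measurableSet_lt measurable_const
      (((Measurable.of_discrete (f := H)).comp hk).const_mul _)
    have herr : (errorProb α 1 SNR d₀ m n Xhat).toReal = τ.real s := rfl
    -- Off the error event the distance is at most `n d₀`; on it, the trivial bound `n` is used.
    have hle : ∀ ω, H (k ω) ≤ n * d₀ + s.indicator (fun _ => (n : ℝ)) ω := by
      intro ω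
      have hn : H (k ω) ≤ n := by
        calc H (k ω) ≤ ∑ _j : Fin n, (1 : ℝ) := Finset.sum_le_sum fun j _ => by
              unfold hamming; split_ifs <;> norm_num
          _ = n := by simp
      by_cases hω : ω ∈ s
      · rw [Set.indicator_of_mem hω]
        nlinarith [mul_nonneg (Nat.cast_nonneg (α := ℝ) n) hd₀]
      · rw [Set.indicator_of_notMem hω, add_zero]
        have hω' : 1 / (n : ℝ) * H (k ω) ≤ d₀ := not_lt.1 hω
        rcases Nat.eq_zero_or_pos n with h0 | h0
        · have : (n : ℝ) = 0 := by exact_mod_cast h0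
          rw [this] at hn ⊢
          linarith
        · have : (0 : ℝ) < n := by exact_mod_cast h0
          rw [one_div_mul_eq_div, div_le_iff₀ this] at hω'
          linarith
    have hind : Integrable (s.indicator fun _ => (n : ℝ)) τ :=
      (integrable_const _).indicator hsm
    refine (integral_mono (hτint H) ((integrable_const _).add hind) hle).trans_eq ?_
    rw [integral_add' (integrable_const _) hind, integral_indicator_const _ hsm, herr]
    simp
    ring
  have hsplit : ∫ ω, F (k ω) ∂τ =
      n * (Real.binEntropy α + Real.log (1 - D)) - B * ∫ ω, H (k ω) ∂τ := by
    have hF : ∀ ω, F (k ω) = (∑ j, -Real.log (bernoulliProb α (ω.1 j)) +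
        n * Real.log (1 - D)) - B * H (k ω) := by
      intro ω
      simp only [F, H, log_backwardRatio hα0 hα1 hD0 hD1', Finset.sum_sub_distrib,
        Finset.sum_add_distrib, Finset.mul_sum]
      simp [k, hB]
    have h1 : Integrable (fun ω : (Fin n → Bool) × (Fin m → Fin n → ℝ) × (Fin m → ℝ) =>
        ∑ j, -Real.log (bernoulliProb α (ω.1 j))) τ :=
      hτint fun p => ∑ j, -Real.log (bernoulliProb α (p.1 j))
    have h2 : ∫ ω : (Fin n → Bool) × (Fin m → Fin n → ℝ) × (Fin m → ℝ),
        ∑ j, -Real.log (bernoulliProb α (ω.1 j)) ∂τ = n * Real.binEntropy α := by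
      rw [integral_prod _ h1, ← integral_sum_neg_log_bernoulliProb]
      simp [hP]
    simp only [hF]
    have h3 : Integrable (fun ω : (Fin n → Bool) × (Fin m → Fin n → ℝ) × (Fin m → ℝ) =>
        ∑ j, -Real.log (bernoulliProb α (ω.1 j)) + n * Real.log (1 - D)) τ :=
      h1.add (integrable_const _)
    rw [integral_sub h3 ((hτint H).const_mul B), integral_add h1 (integrable_const _), h2,
      integral_const_mul B, integral_const]
    simp
    ring
  have := mul_le_mul_of_nonneg_left hham hB0
  linarith

/-! ### Asymptotics -/

/-- A rate above which the number of sensors cannot be, in terms of the crossover probability of a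
test channel. -/
lemma sensingCapacity_le_div (α : unitInterval) {SNR d₀ D r : ℝ} (hα0 : 0 < (α : ℝ))
    (hα1 : (α : ℝ) < 1) (hSNR : 0 ≤ SNR) (hd₀ : 0 ≤ d₀) (hD0 : 0 < D) (hD1 : D ≤ 1 / 2)
    (hr0 : 0 < r) (hr : r < Real.binEntropy α + Real.log (1 - D) -
      (Real.log (1 - D) - Real.log D) * d₀) :
    sensingCapacity α 1 SNR d₀ ≤
      ENNReal.ofReal (1 / 2 * Real.log (1 + α * SNR)) / ENNReal.ofReal r := by
  refine iSup₂_le fun m hm => ?_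
  obtain ⟨hm0, Xhat, hX, hlim⟩ := hm
  set B := Real.log (1 - D) - Real.log D with hB
  have hreal : Tendsto (fun n => (errorProb α 1 SNR d₀ (m n) n (Xhat n)).toReal) atTop
      (nhds 0) := by
    simpa [Function.comp_def] using (ENNReal.tendsto_toReal ENNReal.zero_ne_top).comp hlim
  have hrate : Tendsto (fun n => Real.binEntropy α + Real.log (1 - D) -
      B * (d₀ + (errorProb α 1 SNR d₀ (m n) n (Xhat n)).toReal)) atTop
      (nhds (Real.binEntropy α + Real.log (1 - D) - B * d₀)) := by
    simpa using (tendsto_const_nhds (x := Real.binEntropy α + Real.log (1 - D))).sub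
      (((tendsto_const_nhds (x := d₀)).add hreal).const_mul B)
  refine limsup_le_of_le (by isBoundedDefault) ?_
  -- Since `r` lies strictly below the limiting rate, it is eventually a lower bound for the rate at
  -- length `n`.
  filter_upwards [hrate.eventually_const_le hr] with n hn
  have hbound := rate_le_of_errorProb (m := m n) α hα0 hα1 hSNR hd₀ hD0 hD1 (hX n)
  have hnr : (n : ℝ) * r ≤ m n * (1 / 2 * Real.log (1 + α * SNR)) :=
    (mul_le_mul_of_nonneg_left hn n.cast_nonneg).trans hbound
  have hmn : (m n : ℝ≥0∞) ≠ 0 := by exact_mod_cast (hm0 n).ne'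
  have hr' : ENNReal.ofReal r ≠ 0 := (ENNReal.ofReal_pos.2 hr0).ne'
  rw [ENNReal.le_div_iff_mul_le (.inl hr') (.inl ENNReal.ofReal_ne_top),
    ← ENNReal.mul_div_right_comm, ENNReal.div_le_iff_le_mul (.inl hmn) (.inl (by simp)),
    mul_comm (ENNReal.ofReal (1 / 2 * _))]
  have h := ENNReal.ofReal_le_ofReal hnr
  rwa [ENNReal.ofReal_mul (by positivity), ENNReal.ofReal_mul (by positivity),
    ENNReal.ofReal_natCast, ENNReal.ofReal_natCast] at h

/-- The crossover probability `D = d₀`, or a small one if `d₀ = 0`, is asymptotically optimal. -/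
lemma exists_crossover {h d₀ r : ℝ} (hd₀ : 0 ≤ d₀) (hd₁ : d₀ ≤ 1 / 2)
    (hr : r < h - Real.binEntropy d₀) :
    ∃ D, 0 < D ∧ D ≤ 1 / 2 ∧
      r < h + Real.log (1 - D) - (Real.log (1 - D) - Real.log D) * d₀ := by
  rcases hd₀.eq_or_lt with rfl | hpos
  -- For `d₀ = 0` the term with `log D` is multiplied by zero, so letting `D` decrease to `0` costs
  -- only `log (1 - D) → 0`.
  · have hcont : ContinuousAt (fun D : ℝ => h + Real.log (1 - D)) 0 := by
      refine continuousAt_const.add (ContinuousAt.log (by fun_prop) (by norm_num))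
    have hlt : r < h + Real.log (1 - 0) := by simpa using hr
    have h1 : ∀ᶠ D in nhdsWithin (0 : ℝ) (Set.Ioi 0), r < h + Real.log (1 - D) :=
      (hcont.eventually_const_lt hlt).filter_mono nhdsWithin_le_nhds
    obtain ⟨D, hD, hD'⟩ := (h1.and (Ioc_mem_nhdsGT (by norm_num : (0 : ℝ) < 1 / 2))).exists
    exact ⟨D, hD'.1, hD'.2, by simpa using hD⟩
  · refine ⟨d₀, hpos, hd₁, hr.trans_eq ?_⟩
    simp only [Real.binEntropy, Real.log_inv]
    ring

end Sensing

theorem lemma5p1 (α : unitInterval) (SNR d₀ : ℝ)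
    (hα_pos : 0 < (α : ℝ)) (hα_half : (α : ℝ) ≤ 1 / 2) (hSNR : 0 < SNR)
    (hd₀ : 0 ≤ d₀) (hd₀α : d₀ ≤ α) :
    Sensing.sensingCapacity α 1 SNR d₀ ≤
        ENNReal.ofReal (1 / 2 * Real.log (1 + α * SNR)) /
          Sensing.rateDistortion (bernoulliMeasure true false α) Sensing.hamming d₀ ∧
      ∀ m n : ℕ, Sensing.expectedMutualInfo α 1 SNR m n ≤
        ENNReal.ofReal ((m : ℝ) / 2 * Real.log (1 + α * SNR)) := by
  refine ⟨?_, Sensing.expectedMutualInfo_le α hSNR.le⟩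
  have hα1 : (α : ℝ) < 1 := by linarith
  refine le_trans ?_ (ENNReal.div_le_div_left
    (Sensing.rateDistortion_bernoulli_le α hα_pos hα_half hd₀ hd₀α) _)
  set R := Real.binEntropy α - Real.binEntropy d₀ with hR
  have hlog : 0 < Real.log (1 + α * SNR) := Real.log_pos (by nlinarith)
  -- When `R` is not positive (as for `d₀ = α`), the bound is a positive number over zero, hence
  -- infinite.
  rcases le_or_gt R 0 with hR0 | hR0
  · rw [ENNReal.ofReal_of_nonpos hR0, ENNReal.div_zero (ENNReal.ofReal_pos.2 (by positivity)).ne']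
    exact le_top
  -- The bound holds for each `r` in `(0, R)`; letting `r` increase to `R` gives the claim.
  have hlim : Tendsto (fun r => ENNReal.ofReal (1 / 2 * Real.log (1 + α * SNR)) /
      ENNReal.ofReal r) (nhdsWithin R (Set.Iio R))
      (nhds (ENNReal.ofReal (1 / 2 * Real.log (1 + α * SNR)) / ENNReal.ofReal R)) :=
    ENNReal.Tendsto.const_div ((ENNReal.continuous_ofReal.tendsto R).mono_left nhdsWithin_le_nhds)
      (.inr ENNReal.ofReal_ne_top)
  refine ge_of_tendsto hlim ?_
  filter_upwards [Ioo_mem_nhdsLT hR0] with r hr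
  obtain ⟨D, hD0, hD1, hD⟩ := Sensing.exists_crossover hd₀ (hd₀α.trans hα_half) hr.2
  exact Sensing.sensingCapacity_le_div α hα_pos hα1 hSNR.le hd₀ hD0 hD1 hr.1 hD
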